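/- Let $\theta\in\mathbb R$ and let $\mathcal A=\mathcal A_\theta$ be the rotation algebra (two-dimensional quantum torus), that is, the C*-algebra of operators on $\ell^2(\mathbb Z^2)$ generated by the unitaries $Ue_{k,l}=e^{i\theta l/2}e_{k+1,l}$ and $Ve_{k,l}=e^{-i\theta k/2}e_{k,l+1}$, which satisfy $UV=e^{i\theta}VU$. For $s,t\in\mathbb R$ let $\hat\theta_{s,t}$ be the automorphism of $\mathcal A$ with $\hat\theta_{s,t}(U^kV^l)=e^{-i(sk+tl)}U^kV^l$ for all $k,l\in\mathbb Z$. Let $\mathbb C_{0,0}=\{A\in\mathcal A: UA=AU\}$, and write $\langle S\rangle$ for the (norm-closed, unital) C*-subalgebra of $\mathcal A$ generated by $S\subseteq\mathcal A$. 1. If $\theta/\pi$ is irrational, then $\mathbb C_{0,0}=\langle U\rangle$. 2. If $\theta/\pi=p/q$ with $p\in\mathbb Z$ odd, $q\ge 1$ an integer and $\gcd(p,q)=1$, then $\mathbb C_{0,0}=\langle U,V^{2q}\rangle=\{A\in\mathcal A:\hat\theta_{0,\pi p/q}(A)=A\}$. 3. If $\theta/\pi=2p/q$ with $p\in\mathbb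 Z$, $q\ge 1$ an integer and $\gcd(p,q)=1$, then $\mathbb C_{0,0}=\langle U,V^{q}\rangle=\{A\in\mathcal A:\hat\theta_{0,2\pi/q}(A)=A\}$. -/

import Mathlib

noncomputable section

namespace RotationAlgebra

/-- The Hilbert space `ℓ²(ℤ²)`. -/
abbrev H : Type := lp (fun _ : ℤ × ℤ => ℂ) 2

theorem memlp_shift (w : ℤ × ℤ → Circle) (n : ℤ × ℤ) (f : H) :
    Memℓp (fun x => (w x : ℂ) * f (x - n)) 2 := by
  have h := lp.memℓp f
  rw [memℓp_gen_iff (by norm_num)] at h ⊢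
  have h2 := (Equiv.subRight n).summable_iff.2 h
  simpa [Function.comp_def, Circle.norm_coe] using h2

/-- The weighted translation `f ↦ (x ↦ w x * f (x - n))` on `ℓ²(ℤ²)`, as a linear map; it sends
the basis vector `e_x` to `w (x + n) • e_(x + n)`. -/
def shiftLin (w : ℤ × ℤ → Circle) (n : ℤ × ℤ) : H →ₗ[ℂ] H where
  toFun f := ⟨fun x => (w x : ℂ) * f (x - n), memlp_shift w n f⟩
  map_add' f g := by
    ext x
    exact mul_add _ _ _
  map_smul' c f := by
    ext x
    exact mul_left_comm _ _ _

theorem shiftLin_apply (w : ℤ × ℤ → Circle) (n : ℤ × ℤ) (f : H) (x : ℤ × ℤ) :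
    shiftLin w n f x = (w x : ℂ) * f (x - n) := rfl

theorem norm_shiftLin (w : ℤ × ℤ → Circle) (n : ℤ × ℤ) (f : H) : ‖shiftLin w n f‖ = ‖f‖ := by
  rw [lp.norm_eq_tsum_rpow (by norm_num), lp.norm_eq_tsum_rpow (by norm_num)]
  congr 1
  rw [← (Equiv.subRight n).tsum_eq (fun x => ‖f x‖ ^ (2 : ENNReal).toReal)]
  simp [shiftLin_apply, Circle.norm_coe]

/-- The weighted translation `f ↦ (x ↦ w x * f (x - n))`, with weights of modulus one, as a
unitary operator on `ℓ²(ℤ²)`. -/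
def shift (w : ℤ × ℤ → Circle) (n : ℤ × ℤ) : unitary (H →L[ℂ] H) :=
  Unitary.linearIsometryEquiv.symm
    { shiftLin w n with
      invFun := shiftLin (fun x => (w (x + n))⁻¹) (-n)
      left_inv := fun f => by
        ext x
        change ((w (x + n))⁻¹ : Circle) * (shiftLin w n f (x - -n)) = f x
        simp [shiftLin_apply]
      right_inv := fun f => by
        ext x
        change (w x : ℂ) * (shiftLin (fun x => (w (x + n))⁻¹) (-n) f (x - n)) = f x
        simp [shiftLin_apply]
      norm_map' := norm_shiftLin w n }

theorem shift_apply (w : ℤ × ℤ → Circle) (n : ℤ × ℤ) (f : H) (x : ℤ × ℤ) :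
    (shift w n : H →L[ℂ] H) f x = (w x : ℂ) * f (x - n) := rfl

/-- The operator `U e_(k,l) = e^{iθl/2} e_(k+1,l)` on `ℓ²(ℤ²)`. -/
def opU (θ : ℝ) : unitary (H →L[ℂ] H) := shift (fun x => Circle.exp (θ * x.2 / 2)) (1, 0)

/-- The operator `V e_(k,l) = e^{-iθk/2} e_(k,l+1)` on `ℓ²(ℤ²)`. -/
def opV (θ : ℝ) : unitary (H →L[ℂ] H) := shift (fun x => Circle.exp (-(θ * x.1 / 2))) (0, 1)

/-- The diagonal unitary `e_(k,l) ↦ e^{-i(sk+tl)} e_(k,l)` on `ℓ²(ℤ²)`. -/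
def opD (s t : ℝ) : unitary (H →L[ℂ] H) :=
  shift (fun x => Circle.exp (-(s * x.1 + t * x.2))) 0

/-- The rotation algebra (two-dimensional quantum torus): the C⋆-algebra of operators on `ℓ²(ℤ²)`
generated by the unitaries `U` and `V`. -/
def rotationAlgebra (θ : ℝ) : StarSubalgebra ℂ (H →L[ℂ] H) :=
  (StarAlgebra.adjoin ℂ {(opU θ : H →L[ℂ] H), (opV θ : H →L[ℂ] H)}).topologicalClosure

theorem opU_mem (θ : ℝ) : (opU θ : H →L[ℂ] H) ∈ rotationAlgebra θ :=
  StarSubalgebra.le_topologicalClosure _ (StarAlgebra.subset_adjoin _ _ (by simp))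

theorem opV_mem (θ : ℝ) : (opV θ : H →L[ℂ] H) ∈ rotationAlgebra θ :=
  StarSubalgebra.le_topologicalClosure _ (StarAlgebra.subset_adjoin _ _ (by simp))

/-- The unitary generator `U` of the rotation algebra. -/
def U (θ : ℝ) : unitary (rotationAlgebra θ) :=
  ⟨⟨opU θ, opU_mem θ⟩, by
    rw [Unitary.mem_iff]
    exact ⟨Subtype.ext (Unitary.coe_star_mul_self (opU θ)),
      Subtype.ext (Unitary.coe_mul_star_self (opU θ))⟩⟩

/-- The unitary generator `V` of the rotation algebra. -/
def V (θ : ℝ) : unitary (rotationAlgebra θ) :=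
  ⟨⟨opV θ, opV_mem θ⟩, by
    rw [Unitary.mem_iff]
    exact ⟨Subtype.ext (Unitary.coe_star_mul_self (opV θ)),
      Subtype.ext (Unitary.coe_mul_star_self (opV θ))⟩⟩

/-- The defining relation `UV = e^{iθ} VU`. -/
theorem U_mul_V (θ : ℝ) :
    (U θ : rotationAlgebra θ) * (V θ : rotationAlgebra θ) =
      Complex.exp (Complex.I * θ) • ((V θ : rotationAlgebra θ) * (U θ : rotationAlgebra θ)) := by
  apply Subtype.ext
  change (opU θ : H →L[ℂ] H) * (opV θ : H →L[ℂ] H) =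
    Complex.exp (Complex.I * θ) • ((opV θ : H →L[ℂ] H) * (opU θ : H →L[ℂ] H))
  ext f x
  change (opU θ : H →L[ℂ] H) ((opV θ : H →L[ℂ] H) f) x =
    Complex.exp (Complex.I * θ) * (opV θ : H →L[ℂ] H) ((opU θ : H →L[ℂ] H) f) x
  simp only [opU, opV, shift_apply, Circle.coe_exp]
  rw [← mul_assoc, ← mul_assoc, ← mul_assoc, ← Complex.exp_add, ← Complex.exp_add,
    ← Complex.exp_add, sub_right_comm]
  congr 2
  simp
  ring

/-- Conjugation by the diagonal unitary, on all bounded operators. -/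
def conjD (s t : ℝ) : (H →L[ℂ] H) ≃⋆ₐ[ℂ] (H →L[ℂ] H) :=
  Unitary.conjStarAlgAut ℂ (H →L[ℂ] H) (opD s t)

theorem opD_mul_shift (s t : ℝ) (w : ℤ × ℤ → Circle) (n : ℤ × ℤ) :
    (opD s t : H →L[ℂ] H) * (shift w n : H →L[ℂ] H) =
      Complex.exp (-Complex.I * (s * n.1 + t * n.2)) •
        ((shift w n : H →L[ℂ] H) * (opD s t : H →L[ℂ] H)) := by
  ext f x
  change (opD s t : H →L[ℂ] H) ((shift w n : H →L[ℂ] H) f) x =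
    Complex.exp (-Complex.I * (s * n.1 + t * n.2)) *
      (shift w n : H →L[ℂ] H) ((opD s t : H →L[ℂ] H) f) x
  simp only [opD, shift_apply, Circle.coe_exp, sub_zero]
  rw [mul_left_comm, mul_left_comm (Complex.exp (-Complex.I * (s * n.1 + t * n.2))),
    ← mul_assoc (Complex.exp (-Complex.I * (s * n.1 + t * n.2))), ← Complex.exp_add]
  congr 3
  simp
  ring

theorem conjD_shift (s t : ℝ) (w : ℤ × ℤ → Circle) (n : ℤ × ℤ) :
    conjD s t (shift w n : H →L[ℂ] H) =
      Complex.exp (-Complex.I * (s * n.1 + t * n.2)) • (shift w n : H →L[ℂ] H) := by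
  rw [conjD, Unitary.conjStarAlgAut_apply, opD_mul_shift, smul_mul_assoc, mul_assoc,
    Unitary.mul_star_self_of_mem (opD s t).2, mul_one]

theorem conjD_opU (s t θ : ℝ) :
    conjD s t (opU θ : H →L[ℂ] H) = Complex.exp (-Complex.I * s) • (opU θ : H →L[ℂ] H) := by
  rw [opU, conjD_shift]
  simp

theorem conjD_opV (s t θ : ℝ) :
    conjD s t (opV θ : H →L[ℂ] H) = Complex.exp (-Complex.I * t) • (opV θ : H →L[ℂ] H) := by
  rw [opV, conjD_shift]
  simp

theorem conjD_mem (s t θ : ℝ) {a : H →L[ℂ] H} (ha : a ∈ rotationAlgebra θ) :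
    conjD s t a ∈ rotationAlgebra θ := by
  have hc : Continuous (conjD s t) := by
    change Continuous fun a : H →L[ℂ] H =>
      (opD s t : H →L[ℂ] H) * a * (star (opD s t) : H →L[ℂ] H)
    fun_prop
  have hcl : IsClosed (rotationAlgebra θ : Set (H →L[ℂ] H)) :=
    StarSubalgebra.isClosed_topologicalClosure _
  have key : rotationAlgebra θ ≤
      (rotationAlgebra θ).comap (conjD s t : (H →L[ℂ] H) →⋆ₐ[ℂ] (H →L[ℂ] H)) := by
    refine StarSubalgebra.topologicalClosure_minimal (StarAlgebra.adjoin_le ?_)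
      (hcl.preimage hc)
    rintro x (rfl | rfl)
    · change conjD s t (opU θ : H →L[ℂ] H) ∈ rotationAlgebra θ
      rw [conjD_opU]
      exact SMulMemClass.smul_mem _ (opU_mem θ)
    · change conjD s t (opV θ : H →L[ℂ] H) ∈ rotationAlgebra θ
      rw [conjD_opV]
      exact SMulMemClass.smul_mem _ (opV_mem θ)
  exact key ha

theorem conjD_conjD_neg (s t : ℝ) (a : H →L[ℂ] H) : conjD s t (conjD (-s) (-t) a) = a := by
  have h : opD s t * opD (-s) (-t) = 1 := by
    apply Subtype.ext
    ext f x
    change (opD s t : H →L[ℂ] H) ((opD (-s) (-t) : H →L[ℂ] H) f) x = f x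
    simp only [opD, shift_apply, Circle.coe_exp, sub_zero]
    rw [← mul_assoc, ← Complex.exp_add]
    simp only [Complex.ofReal_neg, Complex.ofReal_add, Complex.ofReal_mul]
    ring_nf
    simp
  rw [conjD, conjD, ← Unitary.conjStarAlgAut_mul_apply, h, map_one]
  rfl

/-- The gauge automorphism `θ̂_(s,t)` of the rotation algebra. -/
def gauge (θ s t : ℝ) : rotationAlgebra θ ≃⋆ₐ[ℂ] rotationAlgebra θ where
  toFun a := ⟨conjD s t a, conjD_mem s t θ a.2⟩
  invFun a := ⟨conjD (-s) (-t) a, conjD_mem (-s) (-t) θ a.2⟩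
  left_inv a := Subtype.ext (by simpa using conjD_conjD_neg (-s) (-t) (a : H →L[ℂ] H))
  right_inv a := Subtype.ext (conjD_conjD_neg s t (a : H →L[ℂ] H))
  map_mul' a b := Subtype.ext (map_mul (conjD s t) (a : H →L[ℂ] H) (b : H →L[ℂ] H))
  map_add' a b := Subtype.ext (map_add (conjD s t) (a : H →L[ℂ] H) (b : H →L[ℂ] H))
  map_star' a := Subtype.ext (map_star (conjD s t) (a : H →L[ℂ] H))
  map_smul' c a := Subtype.ext (map_smul (conjD s t) c (a : H →L[ℂ] H))

theorem map_zpow_of_map {θ : ℝ} (g : rotationAlgebra θ ≃⋆ₐ[ℂ] rotationAlgebra θ)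
    (u : unitary (rotationAlgebra θ)) (r : ℝ)
    (h : g (u : rotationAlgebra θ) = Complex.exp (-Complex.I * r) • (u : rotationAlgebra θ))
    (k : ℤ) :
    g ((u ^ k : unitary (rotationAlgebra θ)) : rotationAlgebra θ) =
      Complex.exp (-Complex.I * (r * k)) •
        ((u ^ k : unitary (rotationAlgebra θ)) : rotationAlgebra θ) := by
  have hn (n : ℕ) : g ((u : rotationAlgebra θ) ^ n) =
      Complex.exp (-Complex.I * (r * n)) • (u : rotationAlgebra θ) ^ n := by
    rw [map_pow, h, smul_pow, ← Complex.exp_nat_mul]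
    congr 2
    ring
  cases k with
  | ofNat n => simpa using hn n
  | negSucc n =>
    have e : ((u ^ (Int.negSucc n) : unitary (rotationAlgebra θ)) : rotationAlgebra θ) =
        star ((u : rotationAlgebra θ) ^ (n + 1)) := by
      rw [zpow_negSucc, ← Unitary.star_eq_inv]
      simp
    rw [e, map_star, hn, star_smul]
    congr 1
    rw [Complex.star_def, ← Complex.exp_conj]
    congr 1
    simp
    ring

/-- `θ̂_(s,t)(U^k V^l) = e^{-i(sk+tl)} U^k V^l` for all integers `k`, `l`. -/
theorem gauge_apply (θ s t : ℝ) (k l : ℤ) :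
    gauge θ s t ((U θ ^ k * V θ ^ l : unitary (rotationAlgebra θ)) : rotationAlgebra θ) =
      Complex.exp (-Complex.I * (s * k + t * l)) •
        ((U θ ^ k * V θ ^ l : unitary (rotationAlgebra θ)) : rotationAlgebra θ) := by
  have hU : gauge θ s t (U θ : rotationAlgebra θ) =
      Complex.exp (-Complex.I * s) • (U θ : rotationAlgebra θ) := Subtype.ext (conjD_opU s t θ)
  have hV : gauge θ s t (V θ : rotationAlgebra θ) =
      Complex.exp (-Complex.I * t) • (V θ : rotationAlgebra θ) := Subtype.ext (conjD_opV s t θ)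
  rw [Submonoid.coe_mul, map_mul, map_zpow_of_map _ _ s hU, map_zpow_of_map _ _ t hV,
    smul_mul_smul_comm, ← Complex.exp_add]
  congr 2
  ring

/-- The set `C_{0,0}` of closed `(0,0)`-forms for the differential basis `U`. -/
def closedForms (θ : ℝ) : Set (rotationAlgebra θ) :=
  {a | ⁅(U θ : rotationAlgebra θ), a⁆ = 0}

/-- The C⋆-subalgebra of the rotation algebra generated by a set: the smallest norm-closed unital
⋆-subalgebra containing it. -/
def generated {θ : ℝ} (S : Set (rotationAlgebra θ)) : StarSubalgebra ℂ (rotationAlgebra θ) :=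
  (StarAlgebra.adjoin ℂ S).topologicalClosure

/-- The set of fixed points of the gauge automorphism `θ̂_(s,t)`. -/
def fixedPoints (θ s t : ℝ) : Set (rotationAlgebra θ) :=
  {a | gauge θ s t a = a}

end RotationAlgebra

end

noncomputable section

namespace RotationAlgebra

variable {θ : ℝ}

/-! An element commutes with `U` iff it is fixed by conjugation by `U`. This conjugation, like the
gauge automorphisms, is an isometry for which every monomial `U ^ k * V ^ l` is an eigenvector, with
eigenvalue depending only on `l`; the monomials span a dense subspace. For such an isometry `T` the
fixed points are the closed span of the fixed monomials, by a mean ergodic argument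
(`mem_of_apply_eq_self`): approximate a fixed `a` by a combination of monomials; its non-fixed part
is a coboundary `T y - y`, and averaging over iterates shows that dropping it does not worsen the
approximation. It remains to find the `l` with trivial eigenvalue (`exp_eq_one_iff_dvd`,
`exp_eq_one_iff_eq_zero`). They are the multiples of some `n`, with `n = 0` when `θ / π` is
irrational. -/

theorem isClosed_rotationAlgebra (θ : ℝ) :
    IsClosed (rotationAlgebra θ : Set (H →L[ℂ] H)) :=
  StarSubalgebra.isClosed_topologicalClosure _

/-- Norm-closedness makes the rotation algebra a C⋆-algebra, and ⋆-automorphisms of C⋆-algebras are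
isometric. -/
theorem norm_starAlgEquiv_apply (g : rotationAlgebra θ ≃⋆ₐ[ℂ] rotationAlgebra θ)
    (a : rotationAlgebra θ) : ‖g a‖ = ‖a‖ :=
  haveI := isClosed_rotationAlgebra θ
  StarAlgEquiv.norm_map g a

/-! ### Commutation phases of the generators -/

theorem conjStarAlgAut_eq_smul_iff {A : Type*} [Ring A] [StarRing A] [Algebra ℂ A] (u : unitary A)
    (x : A) (c : ℂ) :
    Unitary.conjStarAlgAut ℂ A u x = c • x ↔ (u : A) * x = c • (x * (u : A)) := by
  rw [Unitary.conjStarAlgAut_apply]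
  constructor
  · intro h
    rw [← smul_mul_assoc, ← h, mul_assoc, Unitary.coe_star_mul_self, mul_one]
  · intro h
    rw [h, smul_mul_assoc, mul_assoc, ← Unitary.coe_star, Unitary.coe_mul_star_self, mul_one]

theorem conjU_V (θ : ℝ) :
    Unitary.conjStarAlgAut ℂ (rotationAlgebra θ) (U θ) (V θ : rotationAlgebra θ) =
      Complex.exp (-Complex.I * (-θ : ℝ)) • (V θ : rotationAlgebra θ) := by
  rw [conjStarAlgAut_eq_smul_iff, U_mul_V]
  simp

theorem conjU_U (θ : ℝ) :
    Unitary.conjStarAlgAut ℂ (rotationAlgebra θ) (U θ) (U θ : rotationAlgebra θ) = U θ := by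
  simp [mul_assoc]

/-- The phase of `V ^ l` under conjugation by `U` is a commutation relation, which can be read back
as the phase of `U` under conjugation by `V ^ l`. -/
theorem conjV_zpow_U (θ : ℝ) (l : ℤ) :
    Unitary.conjStarAlgAut ℂ (rotationAlgebra θ) (V θ ^ l) (U θ : rotationAlgebra θ) =
      Complex.exp (-Complex.I * (θ * l : ℝ)) • (U θ : rotationAlgebra θ) := by
  have h := map_zpow_of_map _ (V θ) (-θ) (conjU_V θ) l
  rw [conjStarAlgAut_eq_smul_iff] at h ⊢
  rw [h, smul_smul, ← Complex.exp_add]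
  simp

/-- The monomials `U ^ k * V ^ l` commute up to a scalar. -/
theorem exists_V_zpow_mul_U_zpow (θ : ℝ) (k l : ℤ) :
    ∃ c : ℂ, ((V θ ^ l : unitary (rotationAlgebra θ)) : rotationAlgebra θ) *
      ((U θ ^ k : unitary (rotationAlgebra θ)) : rotationAlgebra θ) =
        c • (((U θ ^ k : unitary (rotationAlgebra θ)) : rotationAlgebra θ) *
          ((V θ ^ l : unitary (rotationAlgebra θ)) : rotationAlgebra θ)) := by
  have h := map_zpow_of_map _ (U θ) (θ * l) (conjV_zpow_U θ l) k
  rw [conjStarAlgAut_eq_smul_iff] at h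
  exact ⟨_, h⟩

/-! ### Density of the span of monomials -/

/-- The monomial `U ^ k * V ^ l`. -/
def monomial (θ : ℝ) (k l : ℤ) : rotationAlgebra θ :=
  ((U θ ^ k * V θ ^ l : unitary (rotationAlgebra θ)) : rotationAlgebra θ)

/-- The linear span of the monomials `U ^ k * V ^ l`. -/
def laurentSpan (θ : ℝ) : Submodule ℂ (rotationAlgebra θ) :=
  Submodule.span ℂ (Set.range fun x : ℤ × ℤ => monomial θ x.1 x.2)

theorem monomial_mem_laurentSpan (θ : ℝ) (k l : ℤ) : monomial θ k l ∈ laurentSpan θ :=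
  Submodule.subset_span ⟨(k, l), rfl⟩

theorem monomial_mul_mem (k l k' l' : ℤ) :
    monomial θ k l * monomial θ k' l' ∈ laurentSpan θ := by
  obtain ⟨c, hc⟩ := exists_V_zpow_mul_U_zpow θ k' l
  have : monomial θ k l * monomial θ k' l' = c • monomial θ (k + k') (l + l') := by
    simp only [monomial, zpow_add, Submonoid.coe_mul]
    rw [mul_assoc, ← mul_assoc _ _ ((V θ ^ l' : unitary (rotationAlgebra θ)) : rotationAlgebra θ),
      hc]
    simp only [smul_mul_assoc, mul_smul_comm, mul_assoc]
  rw [this]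
  exact Submodule.smul_mem _ _ (monomial_mem_laurentSpan θ _ _)

/-- The inverse is put in the form of a product of two monomials, so that closure under products
also yields closure under star. -/
theorem zpow_mul_zpow_inv {G : Type*} [Group G] (u v : G) (k l : ℤ) :
    (u ^ k * v ^ l)⁻¹ = (u ^ (0 : ℤ) * v ^ (-l)) * (u ^ (-k) * v ^ (0 : ℤ)) := by
  group

theorem star_monomial (θ : ℝ) (k l : ℤ) :
    star (monomial θ k l) = monomial θ 0 (-l) * monomial θ (-k) 0 :=
  congrArg Subtype.val (zpow_mul_zpow_inv (U θ) (V θ) k l)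

theorem star_monomial_mem (k l : ℤ) : star (monomial θ k l) ∈ laurentSpan θ :=
  Set.mem_of_eq_of_mem (star_monomial θ k l) (monomial_mul_mem 0 (-l) (-k) 0)

theorem mul_mem_laurentSpan {a b : rotationAlgebra θ} (ha : a ∈ laurentSpan θ)
    (hb : b ∈ laurentSpan θ) : a * b ∈ laurentSpan θ := by
  have h := Submodule.mul_mem_mul ha hb
  rw [laurentSpan, Submodule.span_mul_span] at h
  refine Submodule.span_le.2 ?_ h
  rintro _ ⟨_, ⟨x, rfl⟩, _, ⟨y, rfl⟩, rfl⟩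
  exact monomial_mul_mem _ _ _ _

theorem star_mem_laurentSpan {a : rotationAlgebra θ} (ha : a ∈ laurentSpan θ) :
    star a ∈ laurentSpan θ := by
  induction ha using Submodule.span_induction with
  | mem x hx => obtain ⟨y, rfl⟩ := hx; exact star_monomial_mem _ _
  | zero => simp
  | add x y _ _ hx hy => rw [star_add]; exact add_mem hx hy
  | smul c x _ hx => rw [star_smul]; exact Submodule.smul_mem _ _ hx

theorem mem_laurentSpan_of_mem_adjoin {a : rotationAlgebra θ}
    (ha : a ∈ StarAlgebra.adjoin ℂ {(U θ : rotationAlgebra θ), (V θ : rotationAlgebra θ)}) :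
    a ∈ laurentSpan θ := by
  induction ha using StarAlgebra.adjoin_induction with
  | mem x hx =>
    rcases hx with rfl | rfl
    · simpa [monomial] using monomial_mem_laurentSpan θ 1 0
    · simpa [monomial] using monomial_mem_laurentSpan θ 0 1
  | algebraMap r =>
    rw [Algebra.algebraMap_eq_smul_one]
    refine Submodule.smul_mem _ _ ?_
    simpa [monomial] using monomial_mem_laurentSpan θ 0 0
  | add x y _ _ hx hy => exact add_mem hx hy
  | mul x y _ _ hx hy => exact mul_mem_laurentSpan hx hy
  | star x _ hx => exact star_mem_laurentSpan hx

theorem dense_laurentSpan (θ : ℝ) : Dense (laurentSpan θ : Set (rotationAlgebra θ)) := by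
  intro a
  -- Closure is tested among all bounded operators, where the rotation algebra is by definition the
  -- closure of the algebra generated by `opU` and `opV`.
  rw [closure_subtype]
  have hmap : (StarAlgebra.adjoin ℂ
      {(U θ : rotationAlgebra θ), (V θ : rotationAlgebra θ)}).map (rotationAlgebra θ).subtype =
        StarAlgebra.adjoin ℂ {(opU θ : H →L[ℂ] H), (opV θ : H →L[ℂ] H)} := by
    rw [StarAlgHom.map_adjoin, Set.image_pair]
    rfl
  have ha : (a : H →L[ℂ] H) ∈ closure (StarAlgebra.adjoin ℂ
      {(opU θ : H →L[ℂ] H), (opV θ : H →L[ℂ] H)} : Set (H →L[ℂ] H)) := a.2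
  refine closure_mono ?_ ha
  rw [← hmap]
  rintro _ ⟨b, hb, rfl⟩
  exact ⟨b, mem_laurentSpan_of_mem_adjoin hb, rfl⟩

instance : Nontrivial H :=
  ⟨lp.single 2 (0 : ℤ × ℤ) (1 : ℂ), 0, fun h => by
    have h0 := congrArg (fun f : H => f 0) h
    simp at h0⟩

instance : Nontrivial (rotationAlgebra θ) :=
  ⟨1, 0, fun h => one_ne_zero (α := H →L[ℂ] H) (congrArg Subtype.val h)⟩

theorem monomial_ne_zero (θ : ℝ) (k l : ℤ) : monomial θ k l ≠ 0 :=
  (Unitary.toUnits (U θ ^ k * V θ ^ l)).ne_zero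

theorem zpow_mem_starSubalgebra {S : StarSubalgebra ℂ (rotationAlgebra θ)}
    {u : unitary (rotationAlgebra θ)} (hu : (u : rotationAlgebra θ) ∈ S) (k : ℤ) :
    ((u ^ k : unitary (rotationAlgebra θ)) : rotationAlgebra θ) ∈ S := by
  cases k with
  | ofNat n => simpa using pow_mem hu n
  | negSucc n =>
    rw [zpow_negSucc, ← Unitary.star_eq_inv, Unitary.coe_star]
    simpa using pow_mem (star_mem hu) (n + 1)

theorem zpow_natCast_mul_eq {G : Type*} [Group G] (v : G) (n : ℕ) (m : ℤ) :
    v ^ ((n : ℤ) * m) = (v ^ n) ^ m := by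
  rw [zpow_mul, zpow_natCast]

theorem monomial_mem_starSubalgebra {S : StarSubalgebra ℂ (rotationAlgebra θ)} {n : ℕ}
    (hU : (U θ : rotationAlgebra θ) ∈ S)
    (hV : ((V θ ^ n : unitary (rotationAlgebra θ)) : rotationAlgebra θ) ∈ S) (k m : ℤ) :
    monomial θ k (n * m) ∈ S := by
  have h : monomial θ k (n * m) =
      ((U θ ^ k * (V θ ^ n) ^ m : unitary (rotationAlgebra θ)) : rotationAlgebra θ) :=
    congrArg (fun v => ((U θ ^ k * v : unitary (rotationAlgebra θ)) : rotationAlgebra θ))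
      (zpow_natCast_mul_eq (V θ) n m)
  rw [h]
  exact mul_mem (zpow_mem_starSubalgebra hU k) (zpow_mem_starSubalgebra hV m)

/-! ### Mean ergodic argument -/

/-- An element of the span of a set of eigenvectors of `T` is the sum of an element of a submodule
containing the fixed eigenvectors and a coboundary. -/
theorem exists_eq_add_apply_sub_of_mem_span {E : Type*} [AddCommGroup E] [Module ℂ E]
    {T : E →ₗ[ℂ] E} {D : Set E} {F : Submodule ℂ E} (hD : ∀ d ∈ D, ∃ c : ℂ, T d = c • d)
    (hF : ∀ d ∈ D, T d = d → d ∈ F) {p : E} (hp : p ∈ Submodule.span ℂ D) :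
    ∃ f ∈ F, ∃ y, p = f + (T y - y) := by
  induction hp using Submodule.span_induction with
  | mem d hd =>
    obtain ⟨c, hc⟩ := hD d hd
    by_cases h : c = 1
    · exact ⟨d, hF d hd (by simp [hc, h]), 0, by simp⟩
    · refine ⟨0, zero_mem _, (c - 1)⁻¹ • d, ?_⟩
      rw [map_smul, hc, zero_add, ← smul_sub, show c • d - d = (c - 1) • d by rw [sub_smul, one_smul], smul_smul,
        inv_mul_cancel₀ (sub_ne_zero.2 h), one_smul]
  | zero => exact ⟨0, zero_mem _, 0, by simp⟩
  | add p p' _ _ hp hp' =>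
    obtain ⟨f, hf, y, rfl⟩ := hp
    obtain ⟨f', hf', y', rfl⟩ := hp'
    exact ⟨f + f', add_mem hf hf', y + y', by rw [map_add]; abel⟩
  | smul c p _ hp =>
    obtain ⟨f, hf, y, rfl⟩ := hp
    exact ⟨c • f, F.smul_mem _ hf, c • y, by rw [map_smul, smul_add, smul_sub]⟩

/-- If `a` and `f` are fixed by the contraction `T`, a coboundary does not improve the distance from
`f` to `a`. -/
theorem norm_sub_le_of_coboundary {E : Type*} [NormedAddCommGroup E] [NormedSpace ℂ E]
    {T : E →ₗ[ℂ] E} (hT : ∀ x, ‖T x‖ ≤ ‖x‖) {a f y : E} (ha : T a = a) (hf : T f = f) :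
    ‖a - f‖ ≤ ‖a - (f + (T y - y))‖ := by
  set x := a - (f + (T y - y)) with hx
  -- Summing the iterates of `a - f = x + (T y - y)` telescopes the coboundary; `z` is the sum of `T
  -- ^ j x` over `j < N`.
  have key (N : ℕ) : ∃ z, ‖z‖ ≤ N * ‖x‖ ∧ (N : ℂ) • (a - f) = z + ((T ^ N) y - y) := by
    induction N with
    | zero => exact ⟨0, by simp, by simp⟩
    | succ N ih =>
      obtain ⟨z, hz, h⟩ := ih
      refine ⟨T z + x, ?_, ?_⟩
      · push_cast
        linarith [norm_add_le (T z) x, hT z]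
      · have h2 := congrArg T h
        rw [map_smul, map_sub, ha, hf, map_add, map_sub] at h2
        push_cast
        rw [add_smul, h2, one_smul, hx, pow_succ', Module.End.mul_apply]
        abel
  have hpow (N : ℕ) : ‖(T ^ N) y‖ ≤ ‖y‖ := by
    induction N with
    | zero => simp
    | succ N ih => rw [pow_succ', Module.End.mul_apply]; exact (hT _).trans ih
  by_contra! hlt
  -- The boundary term has norm at most `2 * ‖y‖`, so a strict gap between `‖a - f‖` and `‖x‖` fails
  -- once multiplied by a large `N`.
  obtain ⟨N, hN⟩ := exists_nat_gt (2 * ‖y‖ / (‖a - f‖ - ‖x‖))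
  rw [div_lt_iff₀ (sub_pos.2 hlt)] at hN
  obtain ⟨z, hz, h⟩ := key N
  have h3 : N * ‖a - f‖ = ‖z + ((T ^ N) y - y)‖ := by rw [← h, norm_smul]; simp
  linarith [norm_add_le z ((T ^ N) y - y), norm_sub_le ((T ^ N) y) y, hpow N]

/-- The fixed points of a contraction with a dense span of eigenvectors lie in every closed subspace
of fixed points that contains the fixed eigenvectors. -/
theorem mem_of_apply_eq_self {E : Type*} [NormedAddCommGroup E] [NormedSpace ℂ E]
    {T : E →ₗ[ℂ] E} (hT : ∀ x, ‖T x‖ ≤ ‖x‖) {D : Set E} {F : Submodule ℂ E}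
    (hdense : Dense (Submodule.span ℂ D : Set E)) (hD : ∀ d ∈ D, ∃ c : ℂ, T d = c • d)
    (hF : ∀ d ∈ D, T d = d → d ∈ F) (hfix : ∀ f ∈ F, T f = f) (hcl : IsClosed (F : Set E)) {a : E}
    (ha : T a = a) : a ∈ F := by
  rw [← SetLike.mem_coe, ← hcl.closure_eq, Metric.mem_closure_iff]
  intro ε hε
  obtain ⟨p, hp, hap⟩ := Metric.mem_closure_iff.1 (hdense a) ε hε
  obtain ⟨f, hf, y, rfl⟩ := exists_eq_add_apply_sub_of_mem_span hD hF hp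
  refine ⟨f, hf, ?_⟩
  rw [dist_eq_norm] at hap ⊢
  exact (norm_sub_le_of_coboundary hT ha (hfix f hf)).trans_lt hap

/-! ### Fixed points of automorphisms -/

theorem generated_subset_fixed (g : rotationAlgebra θ ≃⋆ₐ[ℂ] rotationAlgebra θ)
    {s : Set (rotationAlgebra θ)} (hs : ∀ x ∈ s, g x = x) {a : rotationAlgebra θ}
    (ha : a ∈ generated s) : g a = a := by
  have hg : Continuous g :=
    (AddMonoidHomClass.isometry_of_norm g (norm_starAlgEquiv_apply g)).continuous
  refine closure_minimal (t := {a | g a = a}) (fun b hb => ?_)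
    (isClosed_eq hg continuous_id) ha
  exact StarAlgHom.adjoin_le_equalizer (g : rotationAlgebra θ →⋆ₐ[ℂ] rotationAlgebra θ)
    (StarAlgHom.id ℂ _) hs hb

/-- The fixed points of an automorphism that fixes `U` and multiplies `V` by a scalar are generated
by `U` and the smallest fixed power of `V`. -/
theorem fixed_eq_generated (g : rotationAlgebra θ ≃⋆ₐ[ℂ] rotationAlgebra θ) {r : ℝ} {n : ℕ}
    (hU : g (U θ : rotationAlgebra θ) = U θ)
    (hV : g (V θ : rotationAlgebra θ) =
      Complex.exp (-Complex.I * r) • (V θ : rotationAlgebra θ))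
    (hr : ∀ l : ℤ, Complex.exp (-Complex.I * (r * l)) = 1 ↔ (n : ℤ) ∣ l) :
    {a | g a = a} = (generated {(U θ : rotationAlgebra θ), (V θ : rotationAlgebra θ) ^ n} :
      Set (rotationAlgebra θ)) := by
  set S := generated {(U θ : rotationAlgebra θ), (V θ : rotationAlgebra θ) ^ n} with hS
  have hgen : ∀ a ∈ S, g a = a := by
    intro a ha
    refine generated_subset_fixed g ?_ ha
    rintro x (rfl | rfl)
    · exact hU
    · have h := map_zpow_of_map g (V θ) r hV n
      rw [(hr n).2 dvd_rfl] at h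
      simpa using h
  have hUS : (U θ : rotationAlgebra θ) ∈ S :=
    StarSubalgebra.le_topologicalClosure _ (StarAlgebra.subset_adjoin _ _ (by simp))
  have hVS : ((V θ ^ n : unitary (rotationAlgebra θ)) : rotationAlgebra θ) ∈ S :=
    StarSubalgebra.le_topologicalClosure _ (StarAlgebra.subset_adjoin _ _ (by simp))
  have hmon (k l : ℤ) : g (monomial θ k l) =
      Complex.exp (-Complex.I * (r * l)) • monomial θ k l := by
    have h := map_zpow_of_map g (U θ) 0 (by simpa using hU) k
    rw [monomial, Submonoid.coe_mul, map_mul, map_zpow_of_map g (V θ) r hV, h]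
    simp
  refine Set.Subset.antisymm (fun a ha => ?_) hgen
  refine mem_of_apply_eq_self (T := (g : rotationAlgebra θ →ₗ[ℂ] rotationAlgebra θ))
    (F := S.toSubalgebra.toSubmodule)
    (fun x => (norm_starAlgEquiv_apply g x).le) (dense_laurentSpan θ) ?_ ?_ hgen
    (StarSubalgebra.isClosed_topologicalClosure _) ha
  · rintro _ ⟨⟨k, l⟩, rfl⟩
    exact ⟨_, hmon k l⟩
  · rintro _ ⟨⟨k, l⟩, rfl⟩ h
    have h1 : Complex.exp (-Complex.I * (r * l)) = 1 := by
      have h2 : Complex.exp (-Complex.I * (r * l)) • monomial θ k l = (1 : ℂ) • monomial θ k l := by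
        rw [← hmon, one_smul]
        exact h
      exact smul_left_injective ℂ (monomial_ne_zero θ k l) h2
    obtain ⟨m, rfl⟩ := (hr l).1 h1
    exact monomial_mem_starSubalgebra hUS hVS k m

theorem closedForms_eq_fixed (θ : ℝ) :
    closedForms θ = {a | Unitary.conjStarAlgAut ℂ (rotationAlgebra θ) (U θ) a = a} := by
  ext a
  have h := conjStarAlgAut_eq_smul_iff (U θ) a 1
  rw [one_smul, one_smul] at h
  rw [Set.mem_ofPred_eq, h, closedForms, Set.mem_ofPred_eq, Ring.lie_def, sub_eq_zero]

theorem closedForms_eq_generated {n : ℕ}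
    (hr : ∀ l : ℤ, Complex.exp (-Complex.I * ((-θ : ℝ) * l)) = 1 ↔ (n : ℤ) ∣ l) :
    closedForms θ = (generated {(U θ : rotationAlgebra θ), (V θ : rotationAlgebra θ) ^ n} :
      Set (rotationAlgebra θ)) := by
  rw [closedForms_eq_fixed]
  exact fixed_eq_generated _ (conjU_U θ) (conjU_V θ) hr

theorem fixedPoints_eq_generated {t : ℝ} {n : ℕ}
    (hr : ∀ l : ℤ, Complex.exp (-Complex.I * (t * l)) = 1 ↔ (n : ℤ) ∣ l) :
    fixedPoints θ 0 t = (generated {(U θ : rotationAlgebra θ), (V θ : rotationAlgebra θ) ^ n} :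
      Set (rotationAlgebra θ)) :=
  fixed_eq_generated _ (by simpa using gauge_apply θ 0 t 1 0)
    (by simpa using gauge_apply θ 0 t 0 1) hr

/-- Needed for `n = 0`, where the second generator `V ^ 0` is `1`. -/
theorem generated_pair_one (θ : ℝ) :
    generated {(U θ : rotationAlgebra θ), 1} = generated {(U θ : rotationAlgebra θ)} := by
  have h : StarAlgebra.adjoin ℂ {(U θ : rotationAlgebra θ), 1} =
      StarAlgebra.adjoin ℂ {(U θ : rotationAlgebra θ)} := by
    refine le_antisymm (StarAlgebra.adjoin_le ?_) (StarAlgebra.adjoin_mono (by simp))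
    rintro x (rfl | rfl)
    · exact StarAlgebra.subset_adjoin _ _ rfl
    · exact one_mem _
  rw [generated, generated, h]

/-! ### Arithmetic of the phases -/

theorem exp_neg_I_mul_eq_one_iff (x : ℝ) :
    Complex.exp (-Complex.I * x) = 1 ↔ ∃ m : ℤ, x / Real.pi = 2 * m := by
  rw [Complex.exp_eq_one_iff]
  have hpi := Real.pi_ne_zero
  constructor
  · rintro ⟨m, hm⟩
    refine ⟨-m, ?_⟩
    have h := congrArg Complex.im hm
    simp at h
    rw [div_eq_iff hpi]
    push_cast
    linarith
  · rintro ⟨m, hm⟩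
    rw [div_eq_iff hpi] at hm
    refine ⟨-m, ?_⟩
    rw [hm]
    push_cast
    ring

/-- For `t = 2π a / n` in lowest terms, `e^{-itl} = 1` exactly when `n ∣ l`. -/
theorem exp_eq_one_iff_dvd {t : ℝ} {a : ℤ} {n : ℕ} (hn : 0 < n) (h : IsCoprime a (n : ℤ))
    (ht : t / Real.pi = 2 * a / n) (l : ℤ) :
    Complex.exp (-Complex.I * (t * l)) = 1 ↔ (n : ℤ) ∣ l := by
  have hn' : (n : ℝ) ≠ 0 := by positivity
  have h1 := exp_neg_I_mul_eq_one_iff (t * l)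
  push_cast at h1
  rw [h1, mul_div_right_comm, ht]
  constructor
  · rintro ⟨m, hm⟩
    refine h.symm.dvd_of_dvd_mul_left (Dvd.intro m ?_)
    field_simp at hm
    have : (a * l : ℝ) = n * m := by linarith
    exact_mod_cast this.symm
  · rintro ⟨m, rfl⟩
    refine ⟨a * m, ?_⟩
    push_cast
    field_simp

theorem exp_eq_one_iff_eq_zero {t : ℝ} (ht : Irrational (t / Real.pi)) (l : ℤ) :
    Complex.exp (-Complex.I * (t * l)) = 1 ↔ ((0 : ℕ) : ℤ) ∣ l := by
  have h1 := exp_neg_I_mul_eq_one_iff (t * l)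
  push_cast at h1
  rw [h1, mul_div_right_comm, Nat.cast_zero, zero_dvd_iff]
  constructor
  · rintro ⟨m, hm⟩
    by_contra hl
    refine (ht.mul_intCast hl).ne_int (2 * m) ?_
    rw [hm]
    push_cast
    rfl
  · rintro rfl
    exact ⟨0, by simp⟩

end RotationAlgebra

end

open RotationAlgebra in
theorem theorem5p1 (θ : ℝ) :
    (Irrational (θ / Real.pi) →
      closedForms θ = (generated {(U θ : rotationAlgebra θ)} : Set (rotationAlgebra θ))) ∧
    (∀ (p : ℤ) (q : ℕ), 0 < q → IsCoprime p (q : ℤ) → Odd p → θ / Real.pi = (p : ℝ) / (q : ℝ) →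
      closedForms θ = (generated {(U θ : rotationAlgebra θ), (V θ : rotationAlgebra θ) ^ (2 * q)} :
        Set (rotationAlgebra θ)) ∧
      closedForms θ = fixedPoints θ 0 (Real.pi * (p : ℝ) / (q : ℝ))) ∧
    (∀ (p : ℤ) (q : ℕ), 0 < q → IsCoprime p (q : ℤ) →
      θ / Real.pi = (2 * (p : ℝ)) / (q : ℝ) →
      closedForms θ = (generated {(U θ : rotationAlgebra θ), (V θ : rotationAlgebra θ) ^ q} :
        Set (rotationAlgebra θ)) ∧
      closedForms θ = fixedPoints θ 0 (2 * Real.pi / (q : ℝ))) := by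
  refine ⟨fun h => ?_, fun p q hq hpq hp h => ?_, fun p q hq hpq h => ?_⟩
  · rw [← generated_pair_one, ← pow_zero (V θ : rotationAlgebra θ)]
    exact closedForms_eq_generated (exp_eq_one_iff_eq_zero (by rw [neg_div]; exact h.neg))
  · have hq' : (q : ℝ) ≠ 0 := by positivity
    have hc : IsCoprime p ((2 * q : ℕ) : ℤ) := by
      push_cast
      obtain ⟨m, hm⟩ := hp
      -- Bézout for the odd `p = 2 * m + 1`: `1 * p + (-m) * 2 = 1`.
      exact IsCoprime.mul_right ⟨1, -m, by rw [hm]; ring⟩ hpq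
    have h1 := closedForms_eq_generated (θ := θ) (n := 2 * q)
      (exp_eq_one_iff_dvd (by positivity) hc.neg_left
        (by rw [neg_div, h]; push_cast; field_simp))
    refine ⟨h1, h1.trans (fixedPoints_eq_generated (exp_eq_one_iff_dvd (by positivity) hc ?_)).symm⟩
    have := Real.pi_ne_zero
    push_cast
    field_simp
  · have hq' : (q : ℝ) ≠ 0 := by positivity
    have h1 := closedForms_eq_generated (θ := θ) (n := q)
      (exp_eq_one_iff_dvd hq hpq.neg_left (by rw [neg_div, h]; push_cast; ring))
    refine ⟨h1, h1.trans (fixedPoints_eq_generated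
      -- The gauge phase `2π / q` and the phase `-θ = -2πp / q` are both of exact order `q`, so they
      -- fix the same monomials.
      (exp_eq_one_iff_dvd (a := 1) hq isCoprime_one_left ?_)).symm⟩
    have := Real.pi_ne_zero
    push_cast
    field_simp
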